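/- Let $\kappa\in\mathbb{R}$ and let $(X,d)$ be a complete CAT($\kappa$) space whose diameter is less than $\frac{\pi}{2\sqrt{\kappa}}$ if $\kappa>0$. Let $x,y,z\in X$ and let $\alpha,\beta\in(0,1)$ satisfy $\alpha+\beta=1$. Then there is exactly one point, denoted $\alpha x+\beta y$, that lies on a geodesic joining $x$ to $y$ at distance $\beta\, d(x,y)$ from $x$, and it satisfies \[ d^2(\alpha x+\beta y,\,z)\;\le\;\frac{\alpha\, d^2(x,z)+\beta\, d^2(y,z)}{\max\{\alpha,\beta\}}\;-\;\alpha\beta\, d^2(x,y). \] Here a geodesic joining $x$ to $y$ is an isometric embedding $\gamma\colon[0,d(x,y)]\to X$ with $\gamma(0)=x$ and $\gamma(d(x,y))=y$. Writing $D_\kappa=\pi/\sqrt{\kappa}$ for $\kappa>0$ and $D_\kappa=\infty$ for $\kappa\le 0$, the space $X$ is CAT($\kappa$) if any two points at distance less than $D_\kappa$ are joined by a geodesic and, for every geodesic triangle of perimeter less than $2D_\kappa$, the distance between any two points of the triangle is at most the distance between the corresponding points of a comparison triangle with the same side lengths in the simply connected complete surface of constant curvature $\kappa$. -/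

import Mathlib

/-- `γ`, restricted to `[0, dist x y]`, is a geodesic joining `x` to `y`: an isometric embedding of
that interval with `γ 0 = x` and `γ (dist x y) = y`. Values outside the interval are irrelevant. -/
structure IsGeodesic {X : Type*} [MetricSpace X] (γ : ℝ → X) (x y : X) : Prop where
  source : γ 0 = x
  target : γ (dist x y) = y
  isometry : ∀ s ∈ Set.Icc (0 : ℝ) (dist x y), ∀ t ∈ Set.Icc (0 : ℝ) (dist x y),
    dist (γ s) (γ t) = |s - t|

/-- `m` is a point `α x + β y` (for `α + β = 1`): it lies on a geodesic joining `x` to `y`, at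
distance `β * dist x y` from `x`. -/
def IsGeodesicCombination {X : Type*} [MetricSpace X] (α β : ℝ) (x y m : X) : Prop :=
  α + β = 1 ∧ ∃ γ : ℝ → X, IsGeodesic γ x y ∧ γ (β * dist x y) = m

/-- A geodesic triangle: vertices `v 0, v 1, v 2` (possibly coinciding) and, for each `i`, a choice
of geodesic `σ i` joining `v i` to `v (i + 1)` (indices modulo `3`). -/
def IsGeodesicTriangle {X : Type*} [MetricSpace X] (v : Fin 3 → X) (σ : Fin 3 → ℝ → X) : Prop :=
  ∀ i, IsGeodesic (σ i) (v i) (v (i + 1))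

/-- The perimeter of a triangle with vertices `v`. -/
noncomputable def perimeter {X : Type*} [MetricSpace X] (v : Fin 3 → X) : ℝ :=
  ∑ i, dist (v i) (v (i + 1))

/-- The triangle `(v, σ)` is no fatter than its comparison triangle `w` in the model plane `M` with
distance function `δ`: for all points `p = σ i s`, `q = σ j t` on its sides and all comparison
points `p'`, `q'` of them on the corresponding sides of `w`, `dist p q ≤ δ p' q'`.
A comparison point of `σ i s` is a point of the segment from `w i` to `w (i + 1)` at distance `s`
from `w i`, that is, a point at distances `s` and `dist (v i) (v (i + 1)) - s` from its ends. -/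
def ComparisonInequality {X : Type*} [MetricSpace X] (v : Fin 3 → X) (σ : Fin 3 → ℝ → X)
    (M : Type*) (δ : M → M → ℝ) : Prop :=
  ∀ w : Fin 3 → M, (∀ i, δ (w i) (w (i + 1)) = dist (v i) (v (i + 1))) →
    ∀ i j : Fin 3, ∀ s ∈ Set.Icc (0 : ℝ) (dist (v i) (v (i + 1))),
      ∀ t ∈ Set.Icc (0 : ℝ) (dist (v j) (v (j + 1))), ∀ p' q' : M,
        δ (w i) p' = s → δ p' (w (i + 1)) = dist (v i) (v (i + 1)) - s →
        δ (w j) q' = t → δ q' (w (j + 1)) = dist (v j) (v (j + 1)) - t →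
        dist (σ i s) (σ j t) ≤ δ p' q'

/-- The comparison inequality with respect to the model plane of constant curvature `κ`: the unit
sphere in `ℝ³` with its angular metric divided by `√κ` if `κ > 0`, the Euclidean plane if `κ = 0`,
and the hyperbolic plane with its metric divided by `√(-κ)` if `κ < 0`. -/
def SatisfiesCATInequality (κ : ℝ) {X : Type*} [MetricSpace X] (v : Fin 3 → X)
    (σ : Fin 3 → ℝ → X) : Prop :=
  (0 < κ → ComparisonInequality v σ (Metric.sphere (0 : EuclideanSpace ℝ (Fin 3)) 1)
    (fun a b => InnerProductGeometry.angle (a : EuclideanSpace ℝ (Fin 3)) b / √κ)) ∧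
  (κ = 0 → ComparisonInequality v σ (EuclideanSpace ℝ (Fin 2)) (fun a b => dist a b)) ∧
  (κ < 0 → ComparisonInequality v σ UpperHalfPlane (fun a b => dist a b / √(-κ)))

/-- `X` is a CAT(`κ`) space. With `D = π / √κ` if `κ > 0` and `D = ∞` if `κ ≤ 0`: any two points at
distance less than `D` are joined by a geodesic, and every geodesic triangle of perimeter less than
`2 * D` satisfies the comparison inequality in the model plane of curvature `κ`. -/
structure IsCATSpace (κ : ℝ) (X : Type*) [MetricSpace X] : Prop where
  exists_geodesic : ∀ x y : X, (0 < κ → dist x y < Real.pi / √κ) →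
    ∃ γ : ℝ → X, IsGeodesic γ x y
  comparison : ∀ (v : Fin 3 → X) (σ : Fin 3 → ℝ → X), IsGeodesicTriangle v σ →
    (0 < κ → perimeter v < 2 * (Real.pi / √κ)) → SatisfiesCATInequality κ v σ

/-!
Along a unit speed geodesic of the model plane, the cosine (`κ > 0`), the square (`κ = 0`) or the
hyperbolic cosine (`κ < 0`) of the distance to a fixed point obeys a linear differential equation,
so its value at the point dividing a segment in the ratio `β : α` is an explicit combination of its
values at the ends. Comparison turns this into an inequality between the distances of `x`, `y`, `z`
and `m = α x + β y`.

For `κ ≠ 0`, let `u` be the cosine which the law of cosines of the model plane assigns to the angle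
at `m` of a triangle with the side lengths of `m`, `x`, `z`. Then `x` and `z` form a hinge at `m`
with angle cosine `u`, and by the inequality just obtained `y` and `z` are at least as far apart as
in a hinge with angle cosine `-u`. Bounding both hinges from below by quadratic expressions and
adding them with weights `α` and `β` cancels `u`. In negative curvature the quadratic expression is
the Euclidean one. In positive curvature one of the two squared sides is lost, so that the sum
controls only `α * dist m z ^ 2` or, with the roles of `x` and `y` exchanged,
`β * dist m z ^ 2`: hence the division by `max α β`.

Two points `α x + β y` coincide because the comparison triangle of `x`, `y` and one of them is
degenerate.
-/

theorem exists_mul_eq_of_abs_le {a b : ℝ} (h : |a| ≤ b) : ∃ u ∈ Set.Icc (-1) 1, b * u = a := by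
  have hb : 0 ≤ b := (abs_nonneg a).trans h
  refine ⟨a / b, abs_le.1 ?_, mul_div_cancel_of_imp' fun h0 => abs_nonpos_iff.1 (h0 ▸ h)⟩
  rw [abs_div, abs_of_nonneg hb]
  exact div_le_one_of_le₀ h hb

theorem exists_sq_eq_sq_add_sq_sub {a b c : ℝ} (hbc : |a - c| ≤ b) (hac : b ≤ a + c) :
    ∃ u ∈ Set.Icc (-1) 1, b ^ 2 = a ^ 2 + c ^ 2 - 2 * a * c * u := by
  have hb : 0 ≤ b := (abs_nonneg _).trans hbc
  have hlower : (a - c) ^ 2 ≤ b ^ 2 := sq_le_sq.2 (hbc.trans (le_abs_self b))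
  have hupper : b ^ 2 ≤ (a + c) ^ 2 := pow_le_pow_left₀ hb hac 2
  obtain ⟨u, hu, h⟩ := exists_mul_eq_of_abs_le (a := a ^ 2 + c ^ 2 - b ^ 2) (b := 2 * a * c)
    (abs_le.2 ⟨by linarith, by linarith⟩)
  exact ⟨u, hu, by linarith⟩

section Trigonometry

open Real

theorem mul_cos_le_sin {x : ℝ} (h₀ : 0 ≤ x) (hπ : x ≤ π) : x * cos x ≤ sin x := by
  rcases lt_or_ge x (π / 2) with hx | hx
  · have hcos : 0 < cos x := cos_pos_of_mem_Ioo ⟨by linarith, hx⟩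
    have htan := le_tan h₀ hx
    rwa [tan_eq_sin_div_cos, le_div_iff₀ hcos] at htan
  · exact (mul_nonpos_of_nonneg_of_nonpos h₀
      (cos_nonpos_of_pi_div_two_le_of_le hx (by linarith))).trans
      (sin_nonneg_of_nonneg_of_le_pi h₀ hπ)

theorem mul_mul_sin_add_le {x y : ℝ} (hx : x ∈ Set.Icc 0 π) (hy : y ∈ Set.Icc 0 π) :
    x * y * sin (x + y) ≤ (x + y) * (sin x * sin y) := by
  have hxy : x * sin x * (y * cos y) ≤ x * sin x * sin y :=
    mul_le_mul_of_nonneg_left (mul_cos_le_sin hy.1 hy.2)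
      (mul_nonneg hx.1 (sin_nonneg_of_mem_Icc hx))
  have hyx : y * sin y * (x * cos x) ≤ y * sin y * sin x :=
    mul_le_mul_of_nonneg_left (mul_cos_le_sin hx.1 hx.2)
      (mul_nonneg hy.1 (sin_nonneg_of_mem_Icc hy))
  rw [sin_add]
  linarith

theorem cos_sub_cos_add_two_mul (x h : ℝ) :
    cos x - cos (x + 2 * h) = 2 * (sin (x + h) * sin h) := by
  rw [cos_sub_cos, show (x + (x + 2 * h)) / 2 = x + h by ring,
    show (x - (x + 2 * h)) / 2 = -h by ring, sin_neg]
  ring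

/-- The tangent line inequality at `s = q ^ 2` for the convex function `s ↦ cos √s`. -/
theorem two_mul_mul_cos_sub_cos_le {q r : ℝ} (hq : q ∈ Set.Icc 0 π) (hr : r ∈ Set.Icc 0 π) :
    2 * q * (cos q - cos r) ≤ (r ^ 2 - q ^ 2) * sin q := by
  rcases le_total q r with hqr | hrq
  · obtain ⟨h, rfl⟩ : ∃ h, r = q + 2 * h := ⟨(r - q) / 2, by ring⟩
    have hh : h ∈ Set.Icc 0 π := ⟨by linarith, by linarith [hq.1, hr.2]⟩
    have hqh : 0 ≤ q + h := add_nonneg hq.1 hh.1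
    have hmid : 0 ≤ sin (q + h) := sin_nonneg_of_nonneg_of_le_pi hqh (by linarith [hr.2, hh.1])
    have hsin : sin h ≤ h := sin_le hh.1
    calc 2 * q * (cos q - cos (q + 2 * h))
        = 4 * (q * sin (q + h) * sin h) := by rw [cos_sub_cos_add_two_mul]; ring
      _ ≤ 4 * (q * sin (q + h) * h) := by
        have := mul_le_mul_of_nonneg_left hsin (mul_nonneg hq.1 hmid)
        linarith
      _ ≤ 4 * ((q + h) * (sin q * sin h)) := by linarith [mul_mul_sin_add_le hq hh]
      _ ≤ 4 * ((q + h) * (sin q * h)) := by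
        have := mul_le_mul_of_nonneg_left hsin (mul_nonneg hqh (sin_nonneg_of_mem_Icc hq))
        linarith
      _ = ((q + 2 * h) ^ 2 - q ^ 2) * sin q := by ring
  · obtain ⟨h, rfl⟩ : ∃ h, q = r + 2 * h := ⟨(q - r) / 2, by ring⟩
    have hh : h ∈ Set.Icc 0 π := ⟨by linarith, by linarith [hr.1, hq.2]⟩
    have hrh : r + h ∈ Set.Icc 0 π := ⟨add_nonneg hr.1 hh.1, by linarith [hq.2, hh.1]⟩
    have hprod := mul_mul_sin_add_le hrh hh
    rw [show r + h + h = r + 2 * h by ring] at hprod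
    calc 2 * (r + 2 * h) * (cos (r + 2 * h) - cos r)
        = -4 * ((r + 2 * h) * (sin (r + h) * sin h)) := by
          linear_combination -2 * (r + 2 * h) * cos_sub_cos_add_two_mul r h
      _ ≤ -4 * ((r + h) * h * sin (r + 2 * h)) := by linarith
      _ = (r ^ 2 - (r + 2 * h) ^ 2) * sin (r + 2 * h) := by ring

/-- Here `u` is the cosine of the angle between the sides `p` and `q` of a spherical triangle with
third side `r`. The Euclidean `p ^ 2` is missing on the left; this loss is the source of the
denominator `max α β` in positive curvature. -/
theorem sq_sub_le_sq_of_cos_le {p q r u : ℝ} (hp₀ : 0 ≤ p) (hpπ : p < π) (hq₀ : 0 ≤ q)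
    (hq : q ≤ π / 2) (hr₀ : 0 ≤ r) (hr : r ≤ π / 2)
    (h : cos r ≤ cos p * cos q + sin p * sin q * u) : q ^ 2 - 2 * p * q * u ≤ r ^ 2 := by
  rcases hq₀.eq_or_lt with rfl | hq₀
  · simp [sq_nonneg]
  have hsinq : 0 < sin q := sin_pos_of_pos_of_lt_pi hq₀ (by linarith)
  have hcosq : 0 ≤ cos q := cos_nonneg_of_mem_Icc ⟨by linarith, hq⟩
  have hcosr : 0 ≤ cos r := cos_nonneg_of_mem_Icc ⟨by linarith, hr⟩
  have hsinp : 0 ≤ p - sin p := sub_nonneg.2 (sin_le hp₀)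
  have hlin : cos p * cos q + sin p * sin q * u ≤ cos q + p * sin q * u := by
    rcases hp₀.eq_or_lt with rfl | hp₀
    · simp
    refine le_of_mul_le_mul_left ?_ (sin_pos_of_pos_of_lt_pi hp₀ hpπ)
    have h₁ := mul_nonneg (hcosr.trans h) hsinp
    have h₂ := mul_nonneg hcosq (sub_nonneg.2 (mul_cos_le_sin hp₀.le hpπ.le))
    linarith
  have htangent : 2 * q * (cos q - cos r) ≤ (r ^ 2 - q ^ 2) * sin q :=
    two_mul_mul_cos_sub_cos_le ⟨hq₀.le, by linarith⟩ ⟨hr₀, by linarith⟩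
  have hcos := mul_le_mul_of_nonneg_left (h.trans hlin) hq₀.le
  refine le_of_mul_le_mul_left ?_ hsinq
  linarith

theorem exists_cos_eq_cos_mul_cos_add {a b c : ℝ} (hbc : |a - c| ≤ b) (hac : b ≤ a + c)
    (hper : a + b + c ≤ 2 * π) :
    ∃ u ∈ Set.Icc (-1) 1, cos b = cos a * cos c + sin a * sin c * u := by
  have hb : 0 ≤ b := (abs_nonneg _).trans hbc
  have hupper : cos b ≤ cos (a - c) := by
    rw [← cos_abs (a - c)]
    exact cos_le_cos_of_nonneg_of_le_pi (abs_nonneg _) (by linarith) hbc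
  have hlower : cos (a + c) ≤ cos b := by
    rcases le_total (a + c) π with hπ | hπ
    · exact cos_le_cos_of_nonneg_of_le_pi hb hπ hac
    · rw [← cos_two_pi_sub (a + c)]
      exact cos_le_cos_of_nonneg_of_le_pi hb (by linarith) (by linarith)
  rw [cos_sub] at hupper
  rw [cos_add] at hlower
  obtain ⟨u, hu, h⟩ := exists_mul_eq_of_abs_le (a := cos b - cos a * cos c) (b := sin a * sin c)
    (abs_le.2 ⟨by linarith, by linarith⟩)
  exact ⟨u, hu, by linarith⟩

theorem mul_sq_le_of_spherical_cevian {a b c d α β : ℝ} (ha : a ≤ π / 2) (hb₀ : 0 ≤ b)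
    (hb : b ≤ π / 2) (hc₀ : 0 < c) (hc : c ≤ π / 2) (hd₀ : 0 ≤ d) (hα : 0 < α) (hβ : 0 < β)
    (hαβ : α + β = 1) (hda : |d - β * c| ≤ a) (had : a ≤ d + β * c)
    (h : sin (α * c) * cos a + sin (β * c) * cos b ≤ sin c * cos d) :
    α * d ^ 2 ≤ α * a ^ 2 + β * b ^ 2 - α ^ 2 * β * c ^ 2 := by
  have ha₀ : 0 ≤ a := (abs_nonneg _).trans hda
  have hsum : α * c + β * c = c := by rw [← add_mul, hαβ, one_mul]
  have hαc : 0 < α * c := mul_pos hα hc₀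
  have hβc : 0 < β * c := mul_pos hβ hc₀
  have hsinα : 0 < sin (α * c) := sin_pos_of_pos_of_lt_pi hαc (by linarith)
  have hsinβ : 0 < sin (β * c) := sin_pos_of_pos_of_lt_pi hβc (by linarith)
  have hsinc : 0 < sin c := sin_pos_of_pos_of_lt_pi hc₀ (by linarith)
  have hd : d ≤ π / 2 := by
    by_contra! hlt
    have hcosa : 0 ≤ cos a := cos_nonneg_of_mem_Icc ⟨by linarith, ha⟩
    have hcosb : 0 ≤ cos b := cos_nonneg_of_mem_Icc ⟨by linarith, hb⟩
    have hcosd : cos d < 0 :=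
      cos_neg_of_pi_div_two_lt_of_lt hlt (by linarith [(abs_le.1 hda).2])
    have := mul_neg_of_pos_of_neg hsinc hcosd
    have : 0 ≤ sin (α * c) * cos a + sin (β * c) * cos b := by positivity
    linarith
  obtain ⟨u, -, hu⟩ := exists_cos_eq_cos_mul_cos_add hda had (by linarith)
  have hβ_hinge : d ^ 2 - 2 * (β * c) * d * u ≤ a ^ 2 :=
    sq_sub_le_sq_of_cos_le hβc.le (by linarith) hd₀ hd ha₀ ha (by rw [hu]; linarith)
  have hα_hinge : (α * c) ^ 2 - 2 * d * (α * c) * -u ≤ b ^ 2 := by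
    refine sq_sub_le_sq_of_cos_le hd₀ (by linarith) hαc.le (by linarith) hb₀ hb ?_
    refine le_of_mul_le_mul_left ?_ hsinβ
    have hsin : sin c = sin (α * c) * cos (β * c) + cos (α * c) * sin (β * c) := by
      rw [← sin_add, hsum]
    rw [hu, hsin] at h
    linarith
  have h₁ := mul_le_mul_of_nonneg_left hβ_hinge hα.le
  have h₂ := mul_le_mul_of_nonneg_left hα_hinge hβ.le
  linarith

theorem sq_le_of_spherical_cevian {a b c d α β : ℝ} (ha : a ≤ π / 2)
    (hb : b ≤ π / 2) (hc₀ : 0 < c) (hc : c ≤ π / 2) (hd₀ : 0 ≤ d) (hα : 0 < α) (hβ : 0 < β)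
    (hαβ : α + β = 1) (hda : |d - β * c| ≤ a) (had : a ≤ d + β * c) (hdb : |d - α * c| ≤ b)
    (hbd : b ≤ d + α * c)
    (h : sin (α * c) * cos a + sin (β * c) * cos b ≤ sin c * cos d) :
    d ^ 2 ≤ (α * a ^ 2 + β * b ^ 2) / max α β - α * β * c ^ 2 := by
  have ha₀ : 0 ≤ a := (abs_nonneg _).trans hda
  have hb₀ : 0 ≤ b := (abs_nonneg _).trans hdb
  have hα_bound := mul_sq_le_of_spherical_cevian ha hb₀ hb hc₀ hc hd₀ hα hβ hαβ hda had h
  have hβ_bound := mul_sq_le_of_spherical_cevian hb ha₀ ha hc₀ hc hd₀ hβ hα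
    (by rwa [add_comm]) hdb hbd (by rwa [add_comm])
  rw [le_sub_iff_add_le, le_div_iff₀ (lt_max_of_lt_left hα)]
  rcases max_choice α β with hm | hm <;> rw [hm] <;> linarith

end Trigonometry

section HyperbolicTrigonometry

open Real

theorem convexOn_cosh_sqrt : ConvexOn ℝ (Set.Ici 0) fun s => cosh √s := by
  have hseries {s : ℝ} (hs : 0 ≤ s) :
      HasSum (fun n : ℕ => s ^ n / ((2 * n).factorial : ℝ)) (cosh √s) := by
    simpa only [pow_mul, sq_sqrt hs] using hasSum_cosh √s
  refine ⟨convex_Ici 0, fun x hx y hy a b ha hb hab => ?_⟩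
  refine hasSum_le (fun n => ?_) (hseries (convex_Ici 0 hx hy ha hb hab))
    (((hseries hx).mul_left a).add ((hseries hy).mul_left b))
  rw [← mul_div_assoc, ← mul_div_assoc, ← add_div]
  gcongr
  exact (convexOn_pow n).2 hx hy ha hb hab

theorem sq_add_sq_sub_le_sq_of_le_cosh {p q r u : ℝ} (hr : 0 ≤ r) (hu : u ∈ Set.Icc (-1) 1)
    (h : cosh p * cosh q - sinh p * sinh q * u ≤ cosh r) :
    p ^ 2 + q ^ 2 - 2 * p * q * u ≤ r ^ 2 := by
  have hconv := convexOn_cosh_sqrt.2 (Set.mem_Ici.2 (sq_nonneg (p - q)))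
    (Set.mem_Ici.2 (sq_nonneg (p + q))) (show 0 ≤ (1 + u) / 2 by linarith [hu.1])
    (show 0 ≤ (1 - u) / 2 by linarith [hu.2]) (by ring)
  simp only [smul_eq_mul, sqrt_sq_eq_abs, cosh_abs] at hconv
  rw [cosh_sub, cosh_add, show (1 + u) / 2 * (p - q) ^ 2 + (1 - u) / 2 * (p + q) ^ 2 =
    p ^ 2 + q ^ 2 - 2 * p * q * u by ring] at hconv
  have hcosh : cosh √(p ^ 2 + q ^ 2 - 2 * p * q * u) ≤ cosh r := by linarith
  rw [cosh_le_cosh, abs_of_nonneg (sqrt_nonneg _), abs_of_nonneg hr] at hcosh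
  exact (sqrt_le_left hr).1 hcosh

theorem exists_cosh_eq_cosh_mul_cosh_sub {a b c : ℝ} (hbc : |a - c| ≤ b) (hac : b ≤ a + c) :
    ∃ u ∈ Set.Icc (-1) 1, cosh b = cosh a * cosh c - sinh a * sinh c * u := by
  have hb : 0 ≤ b := (abs_nonneg _).trans hbc
  have hlower : cosh (a - c) ≤ cosh b := by rwa [cosh_le_cosh, abs_of_nonneg hb]
  have hupper : cosh b ≤ cosh (a + c) := by
    rw [cosh_le_cosh, abs_of_nonneg hb]
    exact hac.trans (le_abs_self _)
  rw [cosh_sub] at hlower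
  rw [cosh_add] at hupper
  obtain ⟨u, hu, h⟩ := exists_mul_eq_of_abs_le (a := cosh a * cosh c - cosh b)
    (b := sinh a * sinh c) (abs_le.2 ⟨by linarith, by linarith⟩)
  exact ⟨u, hu, by linarith⟩

theorem sq_le_of_hyperbolic_cevian {a b c d α β : ℝ} (hb : 0 ≤ b) (hc : 0 < c) (hα : 0 ≤ α)
    (hβ : 0 < β) (hαβ : α + β = 1) (hda : |d - β * c| ≤ a) (had : a ≤ d + β * c)
    (h : sinh c * cosh d ≤ sinh (α * c) * cosh a + sinh (β * c) * cosh b) :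
    d ^ 2 ≤ α * a ^ 2 + β * b ^ 2 - α * β * c ^ 2 := by
  obtain ⟨u, hu, hcosh⟩ := exists_cosh_eq_cosh_mul_cosh_sub hda had
  have hsinh : sinh c = sinh (α * c) * cosh (β * c) + cosh (α * c) * sinh (β * c) := by
    rw [← sinh_add, ← add_mul, hαβ, one_mul]
  have hβ_hinge : d ^ 2 + (β * c) ^ 2 - 2 * d * (β * c) * u ≤ a ^ 2 :=
    sq_add_sq_sub_le_sq_of_le_cosh ((abs_nonneg _).trans hda) hu hcosh.ge
  have hα_hinge : d ^ 2 + (α * c) ^ 2 - 2 * d * (α * c) * -u ≤ b ^ 2 := by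
    refine sq_add_sq_sub_le_sq_of_le_cosh hb ⟨neg_le_neg hu.2, neg_le.1 hu.1⟩
      (le_of_mul_le_mul_left ?_ (sinh_pos_iff.2 (mul_pos hβ hc)))
    rw [hcosh, hsinh] at h
    linarith
  obtain rfl : α = 1 - β := by linarith
  have h₁ := mul_le_mul_of_nonneg_left hβ_hinge hα
  have h₂ := mul_le_mul_of_nonneg_left hα_hinge hβ.le
  linarith

end HyperbolicTrigonometry

section ModelPlanes

open Real InnerProductGeometry

/-- The unit speed great circle of the unit sphere in the plane of the first two coordinates. It
carries the base of the comparison triangles in positive curvature. -/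
noncomputable def greatCircle (s : ℝ) : Metric.sphere (0 : EuclideanSpace ℝ (Fin 3)) 1 :=
  ⟨!₂[cos s, sin s, 0], by simp [EuclideanSpace.norm_eq, Fin.sum_univ_three]⟩

theorem cos_angle_greatCircle (s : ℝ) (w : Metric.sphere (0 : EuclideanSpace ℝ (Fin 3)) 1) :
    cos (angle (greatCircle s : EuclideanSpace ℝ (Fin 3)) w) =
      cos s * w.1 0 + sin s * w.1 1 := by
  rw [← inner_eq_cos_angle_of_norm_eq_one (by simp) (by simp)]
  simp [greatCircle, PiLp.inner_apply, Fin.sum_univ_three, mul_comm]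

theorem angle_greatCircle {s t : ℝ} (hst : s ≤ t) (hts : t - s ≤ π) :
    angle (greatCircle s : EuclideanSpace ℝ (Fin 3)) (greatCircle t) = t - s := by
  refine injOn_cos ⟨angle_nonneg _ _, angle_le_pi _ _⟩ ⟨sub_nonneg.2 hst, hts⟩ ?_
  rw [cos_angle_greatCircle, cos_sub]
  simp [greatCircle, mul_comm]

theorem sin_mul_cos_angle_greatCircle {α β : ℝ} (hαβ : α + β = 1) (c : ℝ)
    (w : Metric.sphere (0 : EuclideanSpace ℝ (Fin 3)) 1) :
    sin c * cos (angle (greatCircle (β * c) : EuclideanSpace ℝ (Fin 3)) w) =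
      sin (α * c) * cos (angle (greatCircle 0 : EuclideanSpace ℝ (Fin 3)) w) +
        sin (β * c) * cos (angle (greatCircle c : EuclideanSpace ℝ (Fin 3)) w) := by
  have hα : α * c = c - β * c := by rw [← one_sub_mul, ← hαβ, add_sub_cancel_right]
  rw [cos_angle_greatCircle, cos_angle_greatCircle, cos_angle_greatCircle, hα, sin_sub, cos_zero,
    sin_zero]
  ring

theorem exists_sphere_triangle {a b c : ℝ} (ha : 0 ≤ a) (hbc : |a - c| ≤ b) (hac : b ≤ a + c)
    (hper : a + b + c ≤ 2 * π) :
    ∃ w : Metric.sphere (0 : EuclideanSpace ℝ (Fin 3)) 1,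
      angle (greatCircle 0 : EuclideanSpace ℝ (Fin 3)) w = a ∧
        angle (greatCircle c : EuclideanSpace ℝ (Fin 3)) w = b := by
  obtain ⟨u, hu, hcos⟩ := exists_cos_eq_cos_mul_cos_add hbc hac hper
  have hsqrt : √(1 - u ^ 2) ^ 2 = 1 - u ^ 2 := sq_sqrt (by nlinarith [hu.1, hu.2])
  let w : Metric.sphere (0 : EuclideanSpace ℝ (Fin 3)) 1 :=
    ⟨!₂[cos a, sin a * u, sin a * √(1 - u ^ 2)], by
      rw [mem_sphere_zero_iff_norm, ← sq_eq_sq₀ (norm_nonneg _) zero_le_one,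
        EuclideanSpace.real_norm_sq_eq]
      simp only [Fin.sum_univ_three, Matrix.cons_val, mul_pow, hsqrt]
      linear_combination sin_sq_add_cos_sq a⟩
  refine ⟨w, injOn_cos ⟨angle_nonneg _ _, angle_le_pi _ _⟩ ⟨ha, ?_⟩ ?_,
    injOn_cos ⟨angle_nonneg _ _, angle_le_pi _ _⟩ ⟨(abs_nonneg _).trans hbc, by linarith⟩ ?_⟩
  · linarith [(abs_le.1 hbc).2]
  · rw [cos_angle_greatCircle]
    simp [w]
  · rw [cos_angle_greatCircle, hcos]
    simp only [w, Matrix.cons_val]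
    ring

/-- The unit speed first coordinate axis of the Euclidean plane. It carries the base of the
comparison triangles in zero curvature. -/
noncomputable def euclideanAxis (s : ℝ) : EuclideanSpace ℝ (Fin 2) := !₂[s, 0]

theorem dist_euclideanAxis (s t : ℝ) : dist (euclideanAxis s) (euclideanAxis t) = |s - t| := by
  simp [euclideanAxis, EuclideanSpace.dist_eq, Real.dist_eq, sqrt_sq_eq_abs]

theorem dist_euclideanAxis_sq (s : ℝ) (w : EuclideanSpace ℝ (Fin 2)) :
    dist (euclideanAxis s) w ^ 2 = (s - w 0) ^ 2 + w 1 ^ 2 := by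
  rw [EuclideanSpace.dist_eq, sq_sqrt (by positivity)]
  simp [euclideanAxis, Real.dist_eq]

theorem dist_euclideanAxis_mul_sq {α β : ℝ} (hαβ : α + β = 1) (c : ℝ)
    (w : EuclideanSpace ℝ (Fin 2)) :
    dist (euclideanAxis (β * c)) w ^ 2 =
      α * dist (euclideanAxis 0) w ^ 2 + β * dist (euclideanAxis c) w ^ 2 - α * β * c ^ 2 := by
  obtain rfl : α = 1 - β := by linarith
  rw [dist_euclideanAxis_sq, dist_euclideanAxis_sq, dist_euclideanAxis_sq]
  ring

theorem exists_euclidean_triangle {a b c : ℝ} (ha : 0 ≤ a) (hbc : |a - c| ≤ b) (hac : b ≤ a + c) :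
    ∃ w : EuclideanSpace ℝ (Fin 2),
      dist (euclideanAxis 0) w = a ∧ dist (euclideanAxis c) w = b := by
  have hb : 0 ≤ b := (abs_nonneg _).trans hbc
  obtain ⟨u, hu, hcos⟩ := exists_sq_eq_sq_add_sq_sub hbc hac
  have hsqrt : √(1 - u ^ 2) ^ 2 = 1 - u ^ 2 := sq_sqrt (by nlinarith [hu.1, hu.2])
  refine ⟨!₂[a * u, a * √(1 - u ^ 2)], (sq_eq_sq₀ dist_nonneg ha).1 ?_,
    (sq_eq_sq₀ dist_nonneg hb).1 ?_⟩
  all_goals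
    rw [dist_euclideanAxis_sq]
    simp only [Matrix.cons_val, mul_pow, hsqrt]
  · ring
  · linear_combination -hcos

/-- The unit speed geodesic of the upper half plane along the imaginary axis. It carries the base of
the comparison triangles in negative curvature. -/
noncomputable def imaginaryAxis (s : ℝ) : UpperHalfPlane := ⟨⟨0, exp s⟩, exp_pos s⟩

theorem dist_imaginaryAxis (s t : ℝ) : dist (imaginaryAxis s) (imaginaryAxis t) = |s - t| := by
  have h : dist (imaginaryAxis s) (imaginaryAxis t) = dist (log (exp s)) (log (exp t)) :=
    UpperHalfPlane.dist_of_re_eq rfl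
  rw [h, log_exp, log_exp, Real.dist_eq]

theorem cosh_dist_imaginaryAxis (s : ℝ) (w : UpperHalfPlane) :
    cosh (dist (imaginaryAxis s) w) =
      (exp s + (w.re ^ 2 + w.im ^ 2) * exp (-s)) / (2 * w.im) := by
  have him : (imaginaryAxis s).im = exp s := rfl
  have hre : (imaginaryAxis s).re = 0 := rfl
  have hw : w.im ≠ 0 := w.im_ne_zero
  rw [UpperHalfPlane.cosh_dist', him, hre, exp_neg]
  field_simp
  ring

theorem sinh_mul_cosh_dist_imaginaryAxis {α β : ℝ} (hαβ : α + β = 1) (c : ℝ) (w : UpperHalfPlane) :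
    sinh c * cosh (dist (imaginaryAxis (β * c)) w) =
      sinh (α * c) * cosh (dist (imaginaryAxis 0) w) +
        sinh (β * c) * cosh (dist (imaginaryAxis c) w) := by
  have hα : α * c = c - β * c := by rw [← one_sub_mul, ← hαβ, add_sub_cancel_right]
  simp only [cosh_dist_imaginaryAxis, hα, sinh_sub, ← cosh_add_sinh, cosh_neg, sinh_neg, cosh_zero,
    sinh_zero, neg_zero]
  ring

theorem exists_upperHalfPlane_triangle {a b c : ℝ} (ha : 0 ≤ a) (hbc : |a - c| ≤ b)
    (hac : b ≤ a + c) :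
    ∃ w : UpperHalfPlane, dist (imaginaryAxis 0) w = a ∧ dist (imaginaryAxis c) w = b := by
  have hb : 0 ≤ b := (abs_nonneg _).trans hbc
  obtain ⟨u, hu, hcosh⟩ := exists_cosh_eq_cosh_mul_cosh_sub hbc hac
  have hsqrt : √(1 - u ^ 2) ^ 2 = 1 - u ^ 2 := sq_sqrt (by nlinarith [hu.1, hu.2])
  have hpos : 0 < cosh a - sinh a * u := by
    have := mul_le_mul_of_nonneg_left hu.2 (sinh_nonneg_iff.2 ha)
    linarith [sinh_lt_cosh a]
  let w : UpperHalfPlane :=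
    ⟨⟨sinh a * √(1 - u ^ 2) / (cosh a - sinh a * u), 1 / (cosh a - sinh a * u)⟩,
      one_div_pos.2 hpos⟩
  have hw (s : ℝ) :
      cosh (dist (imaginaryAxis s) w) = cosh a * cosh s - sinh a * sinh s * u := by
    have hre : w.re = sinh a * √(1 - u ^ 2) / (cosh a - sinh a * u) := rfl
    have him : w.im = 1 / (cosh a - sinh a * u) := rfl
    rw [cosh_dist_imaginaryAxis, hre, him, div_pow, mul_pow, hsqrt, ← cosh_add_sinh,
      ← cosh_add_sinh, cosh_neg, sinh_neg]
    field_simp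
    linear_combination (sinh s - cosh s) * cosh_sq a
  refine ⟨w, cosh_injOn dist_nonneg ha ?_, cosh_injOn dist_nonneg hb ?_⟩
  · rw [hw, cosh_zero, sinh_zero]
    ring
  · rw [hw, hcosh]

end ModelPlanes

section CATSpaces

open Real InnerProductGeometry

variable {X : Type*} [MetricSpace X]

theorem abs_mul_dist_sub_mul_dist_le {k : ℝ} (hk : 0 ≤ k) (p q r : X) :
    |k * dist p q - k * dist p r| ≤ k * dist q r := by
  rw [← mul_sub, abs_mul, abs_of_nonneg hk, dist_comm p q, dist_comm p r]
  exact mul_le_mul_of_nonneg_left (abs_dist_sub_le q r p) hk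

theorem mul_dist_le_add_mul_dist {k : ℝ} (hk : 0 ≤ k) (p q r : X) :
    k * dist q r ≤ k * dist p q + k * dist p r := by
  rw [← mul_add]
  exact mul_le_mul_of_nonneg_left (dist_triangle_left q r p) hk

theorem IsGeodesic.symm {γ : ℝ → X} {x y : X} (hγ : IsGeodesic γ x y) :
    IsGeodesic (fun s => γ (dist x y - s)) y x where
  source := by rw [sub_zero, hγ.target]
  target := by rw [dist_comm y x, sub_self, hγ.source]
  isometry s hs t ht := by
    rw [dist_comm y x] at hs ht
    rw [hγ.isometry _ ⟨by linarith [hs.2], by linarith [hs.1]⟩ _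
      ⟨by linarith [ht.2], by linarith [ht.1]⟩, sub_sub_sub_cancel_left, abs_sub_comm]

theorem IsGeodesicCombination.symm {α β : ℝ} {x y m : X} (hm : IsGeodesicCombination α β x y m) :
    IsGeodesicCombination β α y x m := by
  obtain ⟨hαβ, γ, hγ, rfl⟩ := hm
  refine ⟨by rwa [add_comm], _, hγ.symm, congrArg γ ?_⟩
  rw [dist_comm y x]
  linear_combination -dist x y * hαβ

theorem IsGeodesicCombination.dist_left {α β : ℝ} {x y m : X}
    (hm : IsGeodesicCombination α β x y m) (hα : 0 ≤ α) (hβ : 0 ≤ β) :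
    dist m x = β * dist x y := by
  obtain ⟨hαβ, γ, hγ, rfl⟩ := hm
  have hs : 0 ≤ β * dist x y := mul_nonneg hβ dist_nonneg
  have hs' : β * dist x y ≤ dist x y := mul_le_of_le_one_left dist_nonneg (by linarith)
  have h := hγ.isometry _ ⟨hs, hs'⟩ 0 ⟨le_rfl, dist_nonneg⟩
  rwa [hγ.source, sub_zero, abs_of_nonneg hs] at h

theorem IsGeodesicCombination.dist_right {α β : ℝ} {x y m : X}
    (hm : IsGeodesicCombination α β x y m) (hα : 0 ≤ α) (hβ : 0 ≤ β) :
    dist m y = α * dist x y := by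
  rw [hm.symm.dist_left hβ hα, dist_comm y x]

theorem perimeter_eq (x y z : X) : perimeter ![x, y, z] = dist x y + dist y z + dist z x := by
  simp [perimeter, Fin.sum_univ_three]

/-- The curve `c`, restricted to `[0, L]`, has unit speed and minimizes length for the distance
function `δ`; it serves as the base of a comparison triangle. Only ordered pairs of parameters are
compared, so that no absolute value occurs. -/
def IsUnitSpeedSegment {M : Type*} (δ : M → M → ℝ) (c : ℝ → M) (L : ℝ) : Prop :=
  ∀ ⦃s t⦄, 0 ≤ s → s ≤ t → t ≤ L → δ (c s) (c t) = t - s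

theorem isUnitSpeedSegment_greatCircle {L : ℝ} (hL : L ≤ π) :
    IsUnitSpeedSegment (fun a b : Metric.sphere (0 : EuclideanSpace ℝ (Fin 3)) 1 =>
      angle (a : EuclideanSpace ℝ (Fin 3)) b) greatCircle L :=
  fun _ _ hs hst ht => angle_greatCircle hst (by linarith)

theorem isUnitSpeedSegment_euclideanAxis (L : ℝ) : IsUnitSpeedSegment dist euclideanAxis L :=
  fun s t _ hst _ => by rw [dist_euclideanAxis, abs_sub_comm, abs_of_nonneg (sub_nonneg.2 hst)]

theorem isUnitSpeedSegment_imaginaryAxis (L : ℝ) : IsUnitSpeedSegment dist imaginaryAxis L :=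
  fun s t _ hst _ => by rw [dist_imaginaryAxis, abs_sub_comm, abs_of_nonneg (sub_nonneg.2 hst)]

theorem ComparisonInequality.mul_dist_le {M : Type*} {δ : M → M → ℝ} {k : ℝ} {x y z : X}
    {γ γ₁ γ₂ : ℝ → X}
    (h : ComparisonInequality ![x, y, z] ![γ, γ₁, γ₂] M fun a b => δ a b / k) (hk : 0 < k)
    (hγ₂ : γ₂ 0 = z) {c : ℝ → M} (hc : IsUnitSpeedSegment δ c (k * dist x y)) {w : M}
    (hw : δ w w = 0) (hxw : δ w (c 0) = k * dist z x)
    (hyw : δ (c (k * dist x y)) w = k * dist y z) {β : ℝ} (hβ₀ : 0 ≤ β) (hβ₁ : β ≤ 1) :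
    k * dist (γ (β * dist x y)) z ≤ δ (c (β * (k * dist x y))) w := by
  have hL : 0 ≤ k * dist x y := mul_nonneg hk.le dist_nonneg
  have hs₀ : 0 ≤ β * (k * dist x y) := mul_nonneg hβ₀ hL
  have hs₁ : β * (k * dist x y) ≤ k * dist x y := mul_le_of_le_one_left hL hβ₁
  have hdiv {a b : ℝ} (hab : a = k * b) : a / k = b := by rw [hab, mul_div_cancel_left₀ _ hk.ne']
  have hside : ∀ i, δ (![c 0, c (k * dist x y), w] i) (![c 0, c (k * dist x y), w] (i + 1)) / k =
      dist (![x, y, z] i) (![x, y, z] (i + 1)) := by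
    intro i
    fin_cases i
    · exact hdiv (by simpa using hc le_rfl hL le_rfl)
    · exact hdiv hyw
    · exact hdiv hxw
  have hle := h _ hside 0 2 (β * dist x y)
    ⟨mul_nonneg hβ₀ dist_nonneg, mul_le_of_le_one_left dist_nonneg hβ₁⟩ 0 ⟨le_rfl, dist_nonneg⟩
    (c (β * (k * dist x y))) w
    (hdiv ((hc le_rfl hs₀ hs₁).trans (by ring)))
    (hdiv ((hc hs₀ hs₁ le_rfl).trans (by simp only [Matrix.cons_val, zero_add]; ring)))
    (hdiv (hw.trans (mul_zero k).symm))
    (hdiv (hxw.trans (by simp)))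
  rw [← hγ₂]
  rwa [le_div_iff₀ hk, mul_comm] at hle

/-- The comparison triangle degenerates to a segment, on which `γ (β * dist x y)` and the vertex `z`
have the same comparison point. -/
theorem ComparisonInequality.eq_of_degenerate {M : Type*} {δ : M → M → ℝ}
    (hδ : ∀ a b, δ a b = δ b a) {k : ℝ} {x y z : X} {γ γ₁ γ₂ : ℝ → X}
    (h : ComparisonInequality ![x, y, z] ![γ, γ₁, γ₂] M fun a b => δ a b / k) (hk : 0 < k)
    (hγ₂ : γ₂ 0 = z) {c : ℝ → M} (hc : IsUnitSpeedSegment δ c (k * dist x y)) {β : ℝ}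
    (hβ₀ : 0 ≤ β) (hβ₁ : β ≤ 1) (hzx : dist z x = β * dist x y)
    (hyz : dist y z = (1 - β) * dist x y) : γ (β * dist x y) = z := by
  have hL : 0 ≤ k * dist x y := mul_nonneg hk.le dist_nonneg
  have hs₀ : 0 ≤ β * (k * dist x y) := mul_nonneg hβ₀ hL
  have hs₁ : β * (k * dist x y) ≤ k * dist x y := mul_le_of_le_one_left hL hβ₁
  have hself : δ (c (β * (k * dist x y))) (c (β * (k * dist x y))) = 0 :=
    (hc hs₀ le_rfl hs₁).trans (sub_self _)
  have hle := h.mul_dist_le hk hγ₂ hc hself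
    (by rw [hδ, hc le_rfl hs₀ hs₁, hzx]; ring)
    (by rw [hδ, hc hs₀ hs₁ le_rfl, hyz]; ring) hβ₀ hβ₁
  exact dist_le_zero.1 (nonpos_of_mul_nonpos_right (hle.trans_eq hself) hk)

theorem IsCATSpace.exists_satisfiesCATInequality {κ : ℝ} (hX : IsCATSpace κ X) {α β : ℝ}
    {x y m : X} (hm : IsGeodesicCombination α β x y m) (z : X)
    (hper : 0 < κ → dist x y + dist y z + dist z x < 2 * (π / √κ)) :
    ∃ γ γ₁ γ₂ : ℝ → X, γ (β * dist x y) = m ∧ γ₂ 0 = z ∧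
      SatisfiesCATInequality κ ![x, y, z] ![γ, γ₁, γ₂] := by
  obtain ⟨-, γ, hγ, hγm⟩ := hm
  obtain ⟨γ₁, hγ₁⟩ := hX.exists_geodesic y z fun hκ => by
    linarith [hper hκ, dist_triangle_left y z x, dist_comm x z]
  obtain ⟨γ₂, hγ₂⟩ := hX.exists_geodesic z x fun hκ => by
    linarith [hper hκ, dist_triangle_right z x y, dist_comm z y]
  refine ⟨γ, γ₁, γ₂, hγm, hγ₂.source, hX.comparison _ _ ?_ fun hκ => ?_⟩
  · intro i
    fin_cases i
    exacts [hγ, hγ₁, hγ₂]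
  · rw [perimeter_eq]
    exact hper hκ

variable {κ α β : ℝ} {x y z m : X}

theorem IsCATSpace.mul_dist_le_angle (hX : IsCATSpace κ X) (hκ : 0 < κ)
    (hm : IsGeodesicCombination α β x y m) (hα : 0 ≤ α) (hβ : 0 ≤ β)
    (hper : dist x y + dist y z + dist z x < 2 * (π / √κ))
    {w : Metric.sphere (0 : EuclideanSpace ℝ (Fin 3)) 1}
    (hxw : angle (greatCircle 0 : EuclideanSpace ℝ (Fin 3)) w = √κ * dist x z)
    (hyw : angle (greatCircle (√κ * dist x y) : EuclideanSpace ℝ (Fin 3)) w = √κ * dist y z) :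
    √κ * dist m z ≤
      angle (greatCircle (β * (√κ * dist x y)) : EuclideanSpace ℝ (Fin 3)) w := by
  have hk : 0 < √κ := sqrt_pos.2 hκ
  have hxy : √κ * dist x y ≤ π := by
    rw [mul_comm, ← le_div_iff₀ hk]
    linarith [dist_triangle_right x y z, dist_comm x z]
  obtain ⟨γ, γ₁, γ₂, rfl, hγ₂, h, -⟩ := hX.exists_satisfiesCATInequality hm z fun _ => hper
  exact (h hκ).mul_dist_le hk hγ₂ (isUnitSpeedSegment_greatCircle hxy)
    (angle_self (ne_zero_of_mem_unit_sphere w)) (by rw [angle_comm, hxw, dist_comm]) hyw hβ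
    (by linarith [hm.1])

theorem IsCATSpace.dist_le_dist_euclideanAxis (hX : IsCATSpace 0 X)
    (hm : IsGeodesicCombination α β x y m) (hα : 0 ≤ α) (hβ : 0 ≤ β)
    {w : EuclideanSpace ℝ (Fin 2)} (hxw : dist (euclideanAxis 0) w = dist x z)
    (hyw : dist (euclideanAxis (dist x y)) w = dist y z) :
    dist m z ≤ dist (euclideanAxis (β * dist x y)) w := by
  obtain ⟨γ, γ₁, γ₂, rfl, hγ₂, -, h, -⟩ :=
    hX.exists_satisfiesCATInequality hm z fun h => absurd h (lt_irrefl 0)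
  have h₁ : ComparisonInequality ![x, y, z] ![γ, γ₁, γ₂] (EuclideanSpace ℝ (Fin 2))
      fun a b => dist a b / 1 := by simpa only [div_one] using h rfl
  simpa only [one_mul] using h₁.mul_dist_le one_pos hγ₂ (isUnitSpeedSegment_euclideanAxis _)
    (dist_self w) (by rw [dist_comm, hxw, one_mul, dist_comm]) (by simpa only [one_mul] using hyw)
    hβ (by linarith [hm.1])

theorem IsCATSpace.mul_dist_le_dist_imaginaryAxis (hX : IsCATSpace κ X) (hκ : κ < 0)
    (hm : IsGeodesicCombination α β x y m) (hα : 0 ≤ α) (hβ : 0 ≤ β) {w : UpperHalfPlane}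
    (hxw : dist (imaginaryAxis 0) w = √(-κ) * dist x z)
    (hyw : dist (imaginaryAxis (√(-κ) * dist x y)) w = √(-κ) * dist y z) :
    √(-κ) * dist m z ≤ dist (imaginaryAxis (β * (√(-κ) * dist x y))) w := by
  obtain ⟨γ, γ₁, γ₂, rfl, hγ₂, -, -, h⟩ :=
    hX.exists_satisfiesCATInequality hm z fun h => absurd h hκ.not_gt
  exact (h hκ).mul_dist_le (sqrt_pos.2 (neg_pos.2 hκ)) hγ₂ (isUnitSpeedSegment_imaginaryAxis _)
    (dist_self w) (by rw [dist_comm, hxw, dist_comm z x]) hyw hβ (by linarith [hm.1])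

theorem IsCATSpace.eq_of_isGeodesicCombination (hX : IsCATSpace κ X)
    (hxy : 0 < κ → dist x y < π / √κ) (hα : 0 ≤ α) (hβ : 0 ≤ β) {m' : X}
    (hm : IsGeodesicCombination α β x y m) (hm' : IsGeodesicCombination α β x y m') :
    m = m' := by
  have hx : dist m' x = β * dist x y := hm'.dist_left hα hβ
  have hy : dist y m' = (1 - β) * dist x y := by
    rw [dist_comm, hm'.dist_right hα hβ, ← hm.1, add_sub_cancel_right]
  have hβ₁ : β ≤ 1 := by linarith [hm.1]
  have hper (hκ : 0 < κ) : dist x y + dist y m' + dist m' x < 2 * (π / √κ) := by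
    rw [hy, hx]
    linarith [hxy hκ]
  obtain ⟨γ, γ₁, γ₂, rfl, hγ₂, hpos, hzero, hneg⟩ := hX.exists_satisfiesCATInequality hm m' hper
  rcases lt_trichotomy κ 0 with hκ | hκ | hκ
  · exact (hneg hκ).eq_of_degenerate dist_comm (sqrt_pos.2 (neg_pos.2 hκ)) hγ₂
      (isUnitSpeedSegment_imaginaryAxis _) hβ hβ₁ hx hy
  · have h : ComparisonInequality ![x, y, m'] ![γ, γ₁, γ₂] (EuclideanSpace ℝ (Fin 2))
        fun a b => dist a b / 1 := by simpa only [div_one] using hzero hκ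
    exact h.eq_of_degenerate dist_comm one_pos hγ₂ (isUnitSpeedSegment_euclideanAxis _) hβ hβ₁
      hx hy
  · have hk : 0 < √κ := sqrt_pos.2 hκ
    exact (hpos hκ).eq_of_degenerate (fun _ _ => angle_comm _ _) hk hγ₂
      (isUnitSpeedSegment_greatCircle ((le_div_iff₀' hk).1 (hxy hκ).le)) hβ hβ₁ hx hy

theorem IsCATSpace.existsUnique_isGeodesicCombination (hX : IsCATSpace κ X)
    (hxy : 0 < κ → dist x y < π / √κ) (hα : 0 ≤ α) (hβ : 0 ≤ β) (hαβ : α + β = 1) :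
    ∃! m, IsGeodesicCombination α β x y m := by
  obtain ⟨γ, hγ⟩ := hX.exists_geodesic x y hxy
  have hm : IsGeodesicCombination α β x y (γ (β * dist x y)) := ⟨hαβ, γ, hγ, rfl⟩
  exact ⟨_, hm, fun m' hm' => hX.eq_of_isGeodesicCombination hxy hα hβ hm' hm⟩

theorem IsCATSpace.sin_mul_cos_add_le (hX : IsCATSpace κ X) (hκ : 0 < κ)
    (hm : IsGeodesicCombination α β x y m) (hα : 0 ≤ α) (hβ : 0 ≤ β)
    (hper : dist x y + dist y z + dist z x < 2 * (π / √κ)) :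
    sin (α * (√κ * dist x y)) * cos (√κ * dist x z) +
        sin (β * (√κ * dist x y)) * cos (√κ * dist y z) ≤
      sin (√κ * dist x y) * cos (√κ * dist m z) := by
  have hk : 0 < √κ := sqrt_pos.2 hκ
  have hper' : √κ * dist x z + √κ * dist y z + √κ * dist x y < 2 * π := by
    rw [← mul_div_assoc, lt_div_iff₀ hk, dist_comm z x] at hper
    linarith
  have hxyz : √κ * dist x y ≤ √κ * dist x z + √κ * dist y z := by
    simpa only [dist_comm z] using mul_dist_le_add_mul_dist hk.le z x y
  obtain ⟨w, hxw, hyw⟩ := exists_sphere_triangle (mul_nonneg hk.le dist_nonneg)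
    ((abs_mul_dist_sub_mul_dist_le hk.le x z y).trans_eq (by rw [dist_comm z y]))
    (by linarith [mul_dist_le_add_mul_dist hk.le x y z]) hper'.le
  have hangle := hX.mul_dist_le_angle hκ hm hα hβ hper hxw hyw
  rw [← hxw, ← hyw, ← sin_mul_cos_angle_greatCircle hm.1]
  exact mul_le_mul_of_nonneg_left
    (cos_le_cos_of_nonneg_of_le_pi (mul_nonneg hk.le dist_nonneg) (angle_le_pi _ _) hangle)
    (sin_nonneg_of_nonneg_of_le_pi (mul_nonneg hk.le dist_nonneg) (by linarith))

theorem IsCATSpace.dist_sq_le_of_zero (hX : IsCATSpace 0 X) (hm : IsGeodesicCombination α β x y m)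
    (hα : 0 ≤ α) (hβ : 0 ≤ β) (z : X) :
    dist m z ^ 2 ≤ α * dist x z ^ 2 + β * dist y z ^ 2 - α * β * dist x y ^ 2 := by
  obtain ⟨w, hxw, hyw⟩ := exists_euclidean_triangle (a := dist x z) (b := dist y z)
    (c := dist x y) dist_nonneg
    (by rw [dist_comm x z, dist_comm x y, dist_comm y z]; exact abs_dist_sub_le z y x)
    (by rw [add_comm, dist_comm x y]; exact dist_triangle y x z)
  have hle := pow_le_pow_left₀ dist_nonneg (hX.dist_le_dist_euclideanAxis hm hα hβ hxw hyw) 2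
  rwa [dist_euclideanAxis_mul_sq hm.1, hxw, hyw] at hle

theorem IsCATSpace.sinh_mul_cosh_le (hX : IsCATSpace κ X) (hκ : κ < 0)
    (hm : IsGeodesicCombination α β x y m) (hα : 0 ≤ α) (hβ : 0 ≤ β) (z : X) :
    sinh (√(-κ) * dist x y) * cosh (√(-κ) * dist m z) ≤
      sinh (α * (√(-κ) * dist x y)) * cosh (√(-κ) * dist x z) +
        sinh (β * (√(-κ) * dist x y)) * cosh (√(-κ) * dist y z) := by
  have hk : 0 ≤ √(-κ) := sqrt_nonneg _
  obtain ⟨w, hxw, hyw⟩ := exists_upperHalfPlane_triangle (mul_nonneg hk dist_nonneg)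
    ((abs_mul_dist_sub_mul_dist_le hk x z y).trans_eq (by rw [dist_comm z y]))
    (by linarith [mul_dist_le_add_mul_dist hk x y z])
  rw [← hxw, ← hyw, ← sinh_mul_cosh_dist_imaginaryAxis hm.1]
  refine mul_le_mul_of_nonneg_left ?_ (sinh_nonneg_iff.2 (mul_nonneg hk dist_nonneg))
  rw [cosh_le_cosh, abs_of_nonneg (mul_nonneg hk dist_nonneg), abs_of_nonneg dist_nonneg]
  exact hX.mul_dist_le_dist_imaginaryAxis hκ hm hα hβ hxw hyw

theorem IsCATSpace.dist_sq_le_of_nonpos (hX : IsCATSpace κ X) (hκ : κ ≤ 0)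
    (hm : IsGeodesicCombination α β x y m) (hα : 0 ≤ α) (hβ : 0 < β) (hxy : x ≠ y) (z : X) :
    dist m z ^ 2 ≤ α * dist x z ^ 2 + β * dist y z ^ 2 - α * β * dist x y ^ 2 := by
  rcases hκ.eq_or_lt with rfl | hκ
  · exact hX.dist_sq_le_of_zero hm hα hβ.le z
  have hk : 0 < √(-κ) := sqrt_pos.2 (neg_pos.2 hκ)
  have hmx : √(-κ) * dist m x = β * (√(-κ) * dist x y) := by
    rw [hm.dist_left hα hβ.le, mul_left_comm]
  have h := sq_le_of_hyperbolic_cevian (mul_nonneg hk.le dist_nonneg)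
    (mul_pos hk (dist_pos.2 hxy)) hα hβ hm.1
    (hmx ▸ (abs_mul_dist_sub_mul_dist_le hk.le m z x).trans_eq (by rw [dist_comm z x]))
    (hmx ▸ (mul_dist_le_add_mul_dist hk.le m x z).trans_eq (add_comm _ _))
    (hX.sinh_mul_cosh_le hκ hm hα hβ.le z)
  refine le_of_mul_le_mul_left ?_ (pow_pos hk 2)
  linarith

theorem IsCATSpace.dist_sq_le_of_pos (hX : IsCATSpace κ X) (hκ : 0 < κ)
    (hm : IsGeodesicCombination α β x y m) (hα : 0 < α) (hβ : 0 < β) (hne : x ≠ y)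
    (hxy : dist x y ≤ π / (2 * √κ)) (hyz : dist y z ≤ π / (2 * √κ))
    (hxz : dist x z ≤ π / (2 * √κ)) :
    dist m z ^ 2 ≤
      (α * dist x z ^ 2 + β * dist y z ^ 2) / max α β - α * β * dist x y ^ 2 := by
  have hk : 0 < √κ := sqrt_pos.2 hκ
  have hscale {t : ℝ} (ht : t ≤ π / (2 * √κ)) : √κ * t ≤ π / 2 := by
    rw [le_div_iff₀ (by positivity)] at ht
    linarith
  have hper : dist x y + dist y z + dist z x < 2 * (π / √κ) := by
    rw [← mul_div_assoc, lt_div_iff₀ hk, dist_comm z x]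
    linarith [hscale hxy, hscale hyz, hscale hxz, pi_pos]
  have hmx : √κ * dist m x = β * (√κ * dist x y) := by
    rw [hm.dist_left hα.le hβ.le, mul_left_comm]
  have hmy : √κ * dist m y = α * (√κ * dist x y) := by
    rw [hm.dist_right hα.le hβ.le, mul_left_comm]
  have h := sq_le_of_spherical_cevian (hscale hxz) (hscale hyz) (mul_pos hk (dist_pos.2 hne))
    (hscale hxy) (mul_nonneg hk.le dist_nonneg) hα hβ hm.1
    (hmx ▸ (abs_mul_dist_sub_mul_dist_le hk.le m z x).trans_eq (by rw [dist_comm z x]))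
    (hmx ▸ (mul_dist_le_add_mul_dist hk.le m x z).trans_eq (add_comm _ _))
    (hmy ▸ (abs_mul_dist_sub_mul_dist_le hk.le m z y).trans_eq (by rw [dist_comm z y]))
    (hmy ▸ (mul_dist_le_add_mul_dist hk.le m y z).trans_eq (add_comm _ _))
    (hX.sin_mul_cos_add_le hκ hm hα.le hβ.le hper)
  rw [mul_pow] at h
  refine le_of_mul_le_mul_left (h.trans_eq ?_) (pow_pos hk 2)
  ring

end CATSpaces

theorem dist_lt_of_ediam_univ_lt {X : Type*} [PseudoMetricSpace X] {r : ℝ}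
    (h : Metric.ediam (Set.univ : Set X) < ENNReal.ofReal r) (p q : X) : dist p q < r := by
  have hedist := (Metric.edist_le_ediam_of_mem (Set.mem_univ p) (Set.mem_univ q)).trans_lt h
  rwa [edist_dist, ENNReal.ofReal_lt_ofReal_iff_of_nonneg dist_nonneg] at hedist

theorem lemma2_general {X : Type*} [MetricSpace X] (κ : ℝ) (hX : IsCATSpace κ X) (x y z : X)
    (hxy : 0 < κ → dist x y ≤ Real.pi / (2 * √κ)) (hyz : 0 < κ → dist y z ≤ Real.pi / (2 * √κ))
    (hxz : 0 < κ → dist x z ≤ Real.pi / (2 * √κ)) (α β : ℝ) (hα : 0 < α) (hβ : 0 < β)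
    (hαβ : α + β = 1) :
    (∃! m : X, IsGeodesicCombination α β x y m) ∧
    ∀ m : X, IsGeodesicCombination α β x y m →
      dist m z ^ 2 ≤
        (α * dist x z ^ 2 + β * dist y z ^ 2) / max α β - α * β * dist x y ^ 2 := by
  have hlt (hκ : 0 < κ) : dist x y < Real.pi / √κ := (hxy hκ).trans_lt <| by
    have hk : 0 < √κ := Real.sqrt_pos.2 hκ
    exact div_lt_div_of_pos_left Real.pi_pos hk (by linarith)
  refine ⟨hX.existsUnique_isGeodesicCombination hlt hα.le hβ.le hαβ, fun m hm => ?_⟩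
  have hmax : α * dist x z ^ 2 + β * dist y z ^ 2 ≤
      (α * dist x z ^ 2 + β * dist y z ^ 2) / max α β :=
    le_div_self (by positivity) (lt_max_of_lt_left hα) (max_le (by linarith) (by linarith))
  rcases eq_or_ne x y with rfl | hne
  · obtain rfl : m = x := dist_eq_zero.1 <| by rw [hm.dist_left hα.le hβ.le, dist_self, mul_zero]
    rw [← add_mul, hαβ, one_mul] at hmax ⊢
    rwa [dist_self, zero_pow two_ne_zero, mul_zero, sub_zero]
  rcases le_or_gt κ 0 with hκ | hκ
  · exact (hX.dist_sq_le_of_nonpos hκ hm hα.le hβ hne z).trans (sub_le_sub_right hmax _)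
  · exact hX.dist_sq_le_of_pos hκ hm hα hβ hne (hxy hκ) (hyz hκ) (hxz hκ)

theorem lemma2 {X : Type*} [MetricSpace X] [CompleteSpace X] (κ : ℝ) (hX : IsCATSpace κ X)
    (hdiam : 0 < κ → Metric.ediam (Set.univ : Set X) < ENNReal.ofReal (Real.pi / (2 * √κ)))
    (x y z : X) (α β : ℝ) (hα : α ∈ Set.Ioo (0 : ℝ) 1) (hβ : β ∈ Set.Ioo (0 : ℝ) 1)
    (hαβ : α + β = 1) :
    (∃! m : X, IsGeodesicCombination α β x y m) ∧
    ∀ m : X, IsGeodesicCombination α β x y m →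
      dist m z ^ 2 ≤
        (α * dist x z ^ 2 + β * dist y z ^ 2) / max α β - α * β * dist x y ^ 2 := by
  have hd (p q : X) (hκ : 0 < κ) := (dist_lt_of_ediam_univ_lt (hdiam hκ) p q).le
  exact lemma2_general κ hX x y z (hd x y) (hd y z) (hd x z) α β hα.1 hβ.1 hαβ
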